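/- For a permutation $\pi$ of $\{1,\dots,n\}$, let $|\pi|=n$ and let $\mathrm{fp}(\pi)$, $\mathrm{exc}(\pi)$, $\mathrm{dexc}(\pi)$, $\mathrm{cyc}(\pi)$, $\mathrm{inv}(\pi)$ be its numbers of fixed points, of excedances ($i<\pi(i)$), of double excedances ($i<\pi(i)<\pi(\pi(i))$), of cycles (fixed points included) and of inversions. For sequences $d=(d_1,d_2,\dots)$ and $\ell=(\ell_0,\ell_1,\dots)$ let $$J_{d,\ell}(z)=\cfrac{1}{1-\ell_0z-\cfrac{d_1z^2}{1-\ell_1z-\cfrac{d_2z^2}{1-\ell_2z-\cdots}}}$$ as a formal power series in $z$. Say that $\pi$ has noncrossing cycles if there are no $i<j<k<l$ such that $i,k$ belong to one cycle of $\pi$ and $j,l$ belong to another; and that $\pi$ has unimodal cycles if every cycle, written with its smallest element first as $(a_1,\dots,a_k)$, satisfies $a_1<\dots<a_m>\dots>a_k$ for some $1\le m\le k$. Let $\mathcal A$ be the set of permutations (of all lengths $n\ge0$) with unimodal noncrossing cycles. Let $\mathcal B$ be the set of permutations with increasing excedances and increasing deficiencies, that is, such that $\pi(i)<\pi(j)$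 whenever $i<j$ and either $i<\pi(i)$ and $j<\pi(j)$, or $i>\pi(i)$ and $j>\pi(j)$. Then: 1. $\displaystyle\sum_{\pi\in\mathcal A}x^{\mathrm{fp}(\pi)}v^{\mathrm{exc}(\pi)}w^{\mathrm{dexc}(\pi)}t^{\mathrm{cyc}(\pi)}q^{\mathrm{inv}(\pi)}z^{|\pi|}=J_{d,\ell}(z)$ with $\ell_0=xt$ and, for $h\ge1$, $d_h=vt\,q^{4h-3}$ and $\ell_h=xt\,q^{2h}+(1+vw)q^{2h-1}$. 2. $\displaystyle\sum_{\pi\in\mathcal B}x^{\mathrm{fp}(\pi)}v^{\mathrm{exc}(\pi)}w^{\mathrm{dexc}(\pi)}q^{\mathrm{inv}(\pi)}z^{|\pi|}=J_{d,\ell}(z)$ with $\ell_0=x$ and, for $h\ge1$, $d_h=v\,q^{2h-1}$ and $\ell_h=x\,q^{2h}+(1+vw)q^{h}$. 3. As formal power series, $$\sum_{\pi\in\mathcal A}z^{|\pi|}=\sum_{\pi\in\mathcal B}z^{|\pi|}=J_{d,\ell}(z)=\frac{2}{1+z+\sqrt{1-6z+5z^2}},$$ where here $\ell_0=1$ and $d_h=1$,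 $\ell_h=3$ for $h\ge1$, and the square root is the one with constant term $1$. -/

import Mathlib

open Finset PowerSeries

noncomputable section

/-! Continued fractions over a commutative ring, as formal power series -/

section JFraction

variable {R : Type*} [CommRing R]

/-- The finite continued fraction with `N` levels, starting at level `h`:
`1 / (1 - ℓ_h z - d_{h+1} z² / (1 - ℓ_{h+1} z - ⋯ ))`, the `N`-th tail being replaced by `0`.
Every denominator has constant coefficient `1`. -/
def jConvergent (d l : ℕ → R) : ℕ → ℕ → R⟦X⟧
  | 0, _ => 0
  | N + 1, h =>
      invOfUnit (1 - C (l h) * X - C (d (h + 1)) * X ^ 2 * jConvergent d l N (h + 1)) 1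

/-- The Jacobi continued fraction
`J_{d,ℓ}(z) = 1 / (1 - ℓ_0 z - d_1 z² / (1 - ℓ_1 z - d_2 z² / (1 - ℓ_2 z - ⋯ )))`, i.e. the
coefficientwise limit of its finite truncations (see `coeff_jConvergent`).
The value `d 0` is not used. -/
def jFraction (d l : ℕ → R) : R⟦X⟧ :=
  PowerSeries.mk fun n => coeff n (jConvergent d l (n + 1) 0)

theorem jConvergent_succ_mul (d l : ℕ → R) (N h : ℕ) :
    (1 - C (l h) * X - C (d (h + 1)) * X ^ 2 * jConvergent d l N (h + 1)) *
      jConvergent d l (N + 1) h = 1 := by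
  rw [jConvergent]
  exact mul_invOfUnit _ _ (by simp)

theorem X_pow_dvd_jConvergent_sub (d l : ℕ → R) (N M h : ℕ) (hNM : N ≤ M) :
    (X : R⟦X⟧) ^ N ∣ jConvergent d l M h - jConvergent d l N h := by
  induction N generalizing M h with
  | zero => simp
  | succ N ih =>
    obtain ⟨M, rfl⟩ : ∃ M', M = M' + 1 := ⟨M - 1, by omega⟩
    obtain ⟨c, hc⟩ := ih M (h + 1) (by omega)
    have h1 := jConvergent_succ_mul d l N h
    have h2 := jConvergent_succ_mul d l M h
    refine ⟨jConvergent d l (M + 1) h * jConvergent d l (N + 1) h * C (d (h + 1)) * X * c, ?_⟩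
    linear_combination (-jConvergent d l (M + 1) h) * h1 + jConvergent d l (N + 1) h * h2 +
      jConvergent d l (M + 1) h * jConvergent d l (N + 1) h * C (d (h + 1)) * X ^ 2 * hc

/-- The truncations converge coefficientwise to the continued fraction. -/
theorem coeff_jConvergent (d l : ℕ → R) (n N : ℕ) (hN : n < N) :
    coeff n (jConvergent d l N 0) = coeff n (jFraction d l) := by
  have h := X_pow_dvd_jConvergent_sub d l (n + 1) N 0 hN
  have h' := X_pow_dvd_iff.mp h n (Nat.lt_succ_self n)
  rw [map_sub, sub_eq_zero] at h'
  rw [h', jFraction, coeff_mk]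

end JFraction

/-! Permutation statistics -/

section Statistics

variable {n : ℕ}

/-- Number of fixed points. -/
def fpCount (π : Equiv.Perm (Fin n)) : ℕ := #{i | π i = i}

/-- Number of excedances `i < π(i)`. -/
def excCount (π : Equiv.Perm (Fin n)) : ℕ := #{i | i < π i}

/-- Number of double excedances `i < π(i) < π(π(i))`. -/
def dexcCount (π : Equiv.Perm (Fin n)) : ℕ := #{i | i < π i ∧ π i < π (π i)}

/-- Number of cycles, fixed points included. -/
def cycCount (π : Equiv.Perm (Fin n)) : ℕ := #π.cycleFactorsFinset + fpCount π

/-- Number of inversions. -/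
def invCount (π : Equiv.Perm (Fin n)) : ℕ :=
  #{p : Fin n × Fin n | p.1 < p.2 ∧ π p.2 < π p.1}

/-- The partition of the ground set into the cycles of `π` is noncrossing. -/
def NoncrossingCycles (π : Equiv.Perm (Fin n)) : Prop :=
  ¬ ∃ i j k l : Fin n, i < j ∧ j < k ∧ k < l ∧
    π.SameCycle i k ∧ π.SameCycle j l ∧ ¬ π.SameCycle i j

/-- Every cycle of `π` is unimodal: written with its smallest element first, as
`(a, π a, π² a, …, π^(k-1) a)` where `k` is its length, it increases up to some position `m < k`
and decreases from there on. -/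
def UnimodalCycles (π : Equiv.Perm (Fin n)) : Prop :=
  ∀ a : Fin n, (∀ b, π.SameCycle a b → a ≤ b) →
    ∃ m < Function.minimalPeriod π a,
      StrictMonoOn (fun j : ℕ => (π ^ j) a) (Set.Iic m) ∧
      StrictAntiOn (fun j : ℕ => (π ^ j) a) (Set.Ico m (Function.minimalPeriod π a))

/-- The excedances `π(i) > i`, read from left to right, increase. -/
def IncreasingExcedances (π : Equiv.Perm (Fin n)) : Prop :=
  ∀ i j : Fin n, i < j → i < π i → j < π j → π i < π j

/-- The deficiencies `π(i) < i`, read from left to right, increase. -/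
def IncreasingDeficiencies (π : Equiv.Perm (Fin n)) : Prop :=
  ∀ i j : Fin n, i < j → π i < i → π j < j → π i < π j

end Statistics

open Classical in
/-- The generating function `∑ wt(π) z^n` over all `n ≥ 0` and all permutations `π` of an
`n`-element linearly ordered set that satisfy `P`. -/
def permGF {R : Type*} [CommRing R] (P : ∀ n : ℕ, Equiv.Perm (Fin n) → Prop)
    (wt : ∀ n : ℕ, Equiv.Perm (Fin n) → R) : R⟦X⟧ :=
  PowerSeries.mk fun n => ∑ π : Equiv.Perm (Fin n) with P n π, wt n π

end

/-!
Read `π` from left to right as a Motzkin path: a cycle valley is an up step, a cycle peak a down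
step, any other position a level step. The height before position `k` is the number of arcs
`a ↦ π a` with `a < k ≤ π a`, and also the number of such arcs of `π⁻¹`. These steps determine `π`
up to the choice, at each position where an arc ends, of the one of the `h` open arcs that ends
there. Always taking the open arc of rank `κ h` gives a bijection onto the paths: `κ h = 0`, the
oldest arc, means that excedances and deficiencies increase, and `κ h = h - 1`, the youngest arc,
that no two arcs on the same side cross, which characterises unimodal noncrossing cycles.

For the permutations so obtained the inversion number is a sum of contributions of the steps that
depend only on their heights, and in unimodal cycles the nontrivial cycles correspond to the
valleys. Both generating functions are therefore sums over weighted Motzkin paths, and these are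
J-fractions by Flajolet's theorem.
-/

section JFractionTails

variable {R : Type*} [CommRing R]

theorem jFraction_congr {d d' l l' : ℕ → R} (hd : ∀ h, d (h + 1) = d' (h + 1))
    (hl : ∀ h, l h = l' h) : jFraction d l = jFraction d' l' := by
  have jConvergent_congr : ∀ N h, jConvergent d l N h = jConvergent d' l' N h := by
    intro N
    induction N with
    | zero => exact fun h => rfl
    | succ N ih => exact fun h => by rw [jConvergent, jConvergent, hd, hl, ih]
  simp only [jFraction, jConvergent_congr]

theorem jConvergent_shift (d l : ℕ → R) (a N h : ℕ) :
    jConvergent (fun k => d (a + k)) (fun k => l (a + k)) N h = jConvergent d l N (a + h) := by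
  induction N generalizing h with
  | zero => rfl
  | succ N ih => rw [jConvergent, jConvergent, ih, add_assoc]

/-- The tail `1 / (1 - ℓ_h z - d_{h+1} z² / (1 - ⋯))` of a Jacobi continued fraction. -/
noncomputable def jTail (d l : ℕ → R) (h : ℕ) : R⟦X⟧ :=
  jFraction (fun k => d (h + k)) fun k => l (h + k)

theorem jTail_zero (d l : ℕ → R) : jTail d l 0 = jFraction d l := by
  simp only [jTail, zero_add]

theorem X_pow_dvd_jTail_sub_jConvergent (d l : ℕ → R) (N h : ℕ) :
    (X : R⟦X⟧) ^ N ∣ jTail d l h - jConvergent d l N h := by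
  refine X_pow_dvd_iff.mpr fun m hm => ?_
  rw [map_sub, jTail, ← coeff_jConvergent _ _ m N hm, jConvergent_shift, add_zero, sub_self]

theorem one_sub_mul_jTail (d l : ℕ → R) (h : ℕ) :
    (1 - C (l h) * X - C (d (h + 1)) * X ^ 2 * jTail d l (h + 1)) * jTail d l h = 1 := by
  set D := 1 - C (l h) * X - C (d (h + 1)) * X ^ 2 * jTail d l (h + 1) with hD
  have X_pow_dvd : ∀ N, (X : R⟦X⟧) ^ N ∣ D * jTail d l h - 1 := by
    intro N
    obtain ⟨c, hc⟩ := X_pow_dvd_jTail_sub_jConvergent d l N (h + 1)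
    obtain ⟨c', hc'⟩ := X_pow_dvd_jTail_sub_jConvergent d l (N + 1) h
    refine ⟨D * X * c' - C (d (h + 1)) * X ^ 2 * c * jConvergent d l (N + 1) h, ?_⟩
    linear_combination jConvergent_succ_mul d l N h + D * hc' -
      C (d (h + 1)) * X ^ 2 * jConvergent d l (N + 1) h * hc +
      jConvergent d l (N + 1) h * hD
  ext n
  rw [← sub_eq_zero, ← map_sub]
  exact X_pow_dvd_iff.mp (X_pow_dvd (n + 1)) n n.lt_succ_self

/-- `W n h` plays the role of the total weight of the Motzkin paths of length `n` from height `h`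
to height `0`, a level, up or down step at height `h` having weight `l h`, `u h` or `e h`. -/
theorem coeff_jFraction_of_recurrence {d l u e : ℕ → R} (hd : ∀ h, d (h + 1) = u h * e (h + 1))
    {W : ℕ → ℕ → R} (W_zero_zero : W 0 0 = 1) (W_zero_succ : ∀ h, W 0 (h + 1) = 0)
    (W_succ_zero : ∀ n, W (n + 1) 0 = l 0 * W n 0 + u 0 * W n 1)
    (W_succ_succ : ∀ n h, W (n + 1) (h + 1) =
      l (h + 1) * W n (h + 1) + u (h + 1) * W n (h + 2) + e (h + 1) * W n h) (n : ℕ) :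
    coeff n (jFraction d l) = W n 0 := by
  -- Cutting a path from `h` to `0` at its first visits of `h - 1, …, 0` factors its weight.
  let G : ℕ → R⟦X⟧ := fun h =>
    C (∏ k ∈ range h, e (k + 1)) * X ^ h * ∏ k ∈ range (h + 1), jTail d l k
  have G_zero_eq_jFraction : G 0 = jFraction d l := by simp [G, jTail_zero]
  have G_zero : G 0 = 1 + X * (C (l 0) * G 0 + C (u 0) * G 1) := by
    have h1 := one_sub_mul_jTail d l 0
    simp only [G, hd, map_mul, prod_range_succ, prod_range_zero, map_one] at h1 ⊢
    linear_combination h1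
  have G_succ (h : ℕ) : G (h + 1) =
      X * (C (l (h + 1)) * G (h + 1) + C (u (h + 1)) * G (h + 2) + C (e (h + 1)) * G h) := by
    have h1 := one_sub_mul_jTail d l (h + 1)
    simp only [G, hd, map_mul, prod_range_succ, pow_succ] at h1 ⊢
    linear_combination (C (∏ k ∈ range h, e (k + 1)) * X ^ h * C (e (h + 1)) * X *
      (∏ k ∈ range h, jTail d l k) * jTail d l h) * h1
  have coeff_G : ∀ h, coeff n (G h) = W n h := by
    induction n with
    | zero =>
      rintro (_ | h)
      · rw [G_zero]; simp [W_zero_zero]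
      · rw [G_succ]; simp [W_zero_succ]
    | succ n ih =>
      rintro (_ | h)
      · rw [G_zero]; simp [coeff_succ_X_mul, coeff_one, ih, W_succ_zero]
      · rw [G_succ]; simp [coeff_succ_X_mul, ih, W_succ_succ]
  rw [← G_zero_eq_jFraction, coeff_G]

theorem exists_sqrt_jFraction_eq {K : Type*} [Field K] [NeZero (2 : K)] (a b c : K) :
    ∃ S : K⟦X⟧, S ^ 2 = (1 - C c * X) ^ 2 - 4 * C a * X ^ 2 ∧ constantCoeff S = 1 ∧
      jFraction (fun _ => a) (fun h => if h = 0 then b else c) =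
        2 * (1 + C (c - 2 * b) * X + S)⁻¹ := by
  set d : ℕ → K := fun _ => a
  set l : ℕ → K := fun h => if h = 0 then b else c with hl
  have jTail_two : jTail d l 2 = jTail d l 1 :=
    jFraction_congr (fun _ => rfl) fun h => by simp [hl]
  have h0 := one_sub_mul_jTail d l 0
  have h1 := one_sub_mul_jTail d l 1
  rw [jTail_two, show l 1 = c from if_neg one_ne_zero] at h1
  rw [jTail_zero, show l 0 = b from if_pos rfl] at h0
  refine ⟨1 - C c * X - 2 * C a * X ^ 2 * jTail d l 1, ?_, by simp, ?_⟩
  · linear_combination (-4 * C a * X ^ 2) * h1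
  · rw [PowerSeries.eq_mul_inv_iff_mul_eq (by simp [one_add_one_eq_two, NeZero.ne])]
    simp only [map_sub, map_mul, map_ofNat]
    linear_combination 2 * h0

end JFractionTails

section Paths

/-- The local shapes of a permutation at a point `i`, according to the positions of `π i` and
`π⁻¹ i` relative to `i`. They are the steps of a coloured Motzkin path. -/
inductive CycleShape
  | fixedPoint
  | valley
  | peak
  | doubleRise
  | doubleFall
  deriving DecidableEq

instance : Fintype CycleShape where
  elems := {.fixedPoint, .valley, .peak, .doubleRise, .doubleFall}
  complete s := by cases s <;> decide

theorem CycleShape.sum_univ {M : Type*} [AddCommMonoid M] (f : CycleShape → M) :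
    ∑ s, f s = f .fixedPoint + f .valley + f .peak + f .doubleRise + f .doubleFall := by
  have univ_eq : (univ : Finset CycleShape) =
    {.fixedPoint, .valley, .peak, .doubleRise, .doubleFall} := rfl
  simp [univ_eq, add_assoc]

/-- The height difference of a step. -/
def CycleShape.rise : CycleShape → ℤ
  | valley => 1
  | peak => -1
  | _ => 0

/-- The height that a path starting at height `0` has before step number `k`. -/
def pathHeight {n : ℕ} (w : Fin n → CycleShape) (k : ℕ) : ℤ :=
  ∑ j : Fin n, if (j : ℕ) < k then (w j).rise else 0

theorem pathHeight_zero {n : ℕ} (w : Fin n → CycleShape) : pathHeight w 0 = 0 := by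
  simp [pathHeight]

theorem pathHeight_cons_succ {n : ℕ} (s : CycleShape) (w : Fin n → CycleShape) (k : ℕ) :
    pathHeight (Fin.cons s w : Fin (n + 1) → CycleShape) (k + 1) = s.rise + pathHeight w k := by
  simp [pathHeight, Fin.sum_univ_succ]

variable {R : Type*} [CommRing R]

/-- The total weight of the paths of `n` steps from height `h` to height `0`, where a step `s` at
height `h` has weight `ω h s`. Paths below the axis are not excluded; they have weight `0` if
`ω 0 peak = 0`. -/
def pathSum (ω : ℕ → CycleShape → R) (n h : ℕ) : R :=
  ∑ w : Fin n → CycleShape with h + pathHeight w n = 0,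
    ∏ i : Fin n, ω (h + pathHeight w i).toNat (w i)

theorem pathSum_zero (ω : ℕ → CycleShape → R) (h : ℕ) :
    pathSum ω 0 h = if h = 0 then 1 else 0 := by
  rcases h with _ | h
  · simp [pathSum, pathHeight]
  · simp [pathSum, pathHeight, Nat.cast_add_one_ne_zero]

theorem pathSum_succ {ω : ℕ → CycleShape → R} (hω : ω 0 .peak = 0) (n h : ℕ) :
    pathSum ω (n + 1) h = ∑ s, ω h s * pathSum ω n (h + s.rise).toNat := by
  simp only [pathSum, sum_filter]
  rw [← (Fin.consEquiv fun _ => CycleShape).sum_comp, Fintype.sum_prod_type]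
  refine sum_congr rfl fun s _ => ?_
  rw [mul_sum]
  refine sum_congr rfl fun w _ => ?_
  have cons_eq : Fin.consEquiv (fun _ => CycleShape) (s, w) =
    (Fin.cons s w : Fin (n + 1) → CycleShape) := rfl
  simp only [cons_eq, pathHeight_cons_succ, pathHeight_zero, Fin.prod_univ_succ, Fin.cons_zero,
    Fin.cons_succ, Fin.val_zero, Fin.val_succ, add_zero, Int.toNat_natCast]
  have zero_or_nonneg : ω h s = 0 ∨ 0 ≤ h + s.rise := by
    rcases h with _ | h
    · cases s <;> simp [CycleShape.rise, hω]
    · cases s <;> simp only [Nat.cast_add, Nat.cast_one, CycleShape.rise] <;> omega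
  rcases zero_or_nonneg with h0 | hnonneg
  · simp [h0]
  · simp only [Int.toNat_of_nonneg hnonneg, add_assoc, mul_ite, mul_zero]

theorem coeff_jFraction_eq_pathSum {d l : ℕ → R} {ω : ℕ → CycleShape → R} (hω : ω 0 .peak = 0)
    (hd : ∀ h, d (h + 1) = ω h .valley * ω (h + 1) .peak)
    (hl : ∀ h, l h = ω h .fixedPoint + ω h .doubleRise + ω h .doubleFall) (n : ℕ) :
    coeff n (jFraction d l) = pathSum ω n 0 := by
  refine coeff_jFraction_of_recurrence (u := fun h => ω h .valley) (e := fun h => ω h .peak) hd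
    (by simp [pathSum_zero]) (by simp [pathSum_zero])
    (fun n => ?_) (fun n h => ?_) n
  · simp only [pathSum_succ hω, CycleShape.sum_univ, CycleShape.rise, hω, hl,
      CharP.cast_eq_zero, add_zero, zero_add, Int.toNat_zero, Int.toNat_one, Int.reduceNeg,
      Int.reduceToNat, zero_mul]
    ring
  · have toNat_add_two : ((h : ℤ) + 1 + 1).toNat = h + 2 := by omega
    simp only [pathSum_succ hω, CycleShape.sum_univ, CycleShape.rise, hl,
      Nat.cast_add, Nat.cast_one, add_zero, Int.toNat_natCast_add_one, toNat_add_two,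
      Int.reduceNeg, add_neg_cancel_right, Int.toNat_natCast]
    ring

end Paths

section RankMatchings

variable {α : Type*} [LinearOrder α] {κ : ℕ → ℕ} {S T : Finset α} {f g : α → α}

theorem strictMonoOn_card_filter_lt (S : Finset α) :
    StrictMonoOn (fun s => #{a ∈ S | a < s}) (S : Set α) := by
  intro s hs t _ hst
  refine card_lt_card ((ssubset_iff_of_subset fun a => ?_).mpr ⟨s, by simp_all, by simp⟩)
  simp only [mem_filter]
  exact fun ha => ⟨ha.1, ha.2.trans hst⟩

theorem exists_card_filter_lt_eq {k : ℕ} (hk : k < #S) : ∃ s ∈ S, #{a ∈ S | a < s} = k := by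
  have mapsTo : Set.MapsTo (fun s => #{a ∈ S | a < s}) S (range #S) := fun s hs =>
    mem_coe.mpr <| mem_range.mpr <| card_lt_card <| filter_ssubset.mpr ⟨s, hs, lt_irrefl s⟩
  exact surjOn_of_injOn_of_card_le _ mapsTo (strictMonoOn_card_filter_lt S).injOn
    (card_range _).le (mem_coe.mpr (mem_range.mpr hk))

/-- `f` matches the sources `S` with the targets `T`, every source lying to the left of its target.
If the targets are scanned from left to right, each is matched with the source of rank `κ h`,
ranks starting from `0`, among the `h` sources to its left that are not matched yet. -/
structure IsRankMatching (κ : ℕ → ℕ) (S T : Finset α) (f : α → α) : Prop where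
  bijOn : Set.BijOn f S T
  lt_apply : ∀ s ∈ S, s < f s
  rank : ∀ s ∈ S, #{a ∈ S | a < s ∧ f s < f a} = κ #{a ∈ S | a < f s ∧ f s ≤ f a}

theorem IsRankMatching.congr (hf : IsRankMatching κ S T f) (hfg : Set.EqOn f g S) :
    IsRankMatching κ S T g where
  bijOn := hf.bijOn.congr hfg
  lt_apply s hs := hfg hs ▸ hf.lt_apply s hs
  rank s hs := by
    have filter_eq (P : α → α → Prop) [DecidableRel P] :
        {a ∈ S | P a (g a)} = {a ∈ S | P a (f a)} := filter_congr fun a ha => by rw [hfg ha]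
    rw [← hfg hs, filter_eq fun a b => a < s ∧ f s < b, filter_eq fun a b => a < f s ∧ f s ≤ b]
    exact hf.rank s hs

theorem rank_insert_iff {s : α} (hlt : ∀ a ∈ S, f s < f a) :
    (∀ b ∈ insert s S, #{a ∈ insert s S | a < b ∧ f b < f a} =
        κ #{a ∈ insert s S | a < f b ∧ f b ≤ f a}) ↔
      #{a ∈ insert s S | a < s} = κ #{a ∈ insert s S | a < f s} ∧
        ∀ b ∈ S, #{a ∈ S | a < b ∧ f b < f a} = κ #{a ∈ S | a < f b ∧ f b ≤ f a} := by
  rw [forall_mem_insert]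
  refine and_congr ?_ (forall₂_congr fun b hb => ?_)
  · have unmatched_lt : {a ∈ insert s S | a < s ∧ f s < f a} = {a ∈ insert s S | a < s} := by
      refine filter_congr fun a ha => and_iff_left_of_imp fun has => ?_
      exact hlt a ((mem_insert.mp ha).resolve_left has.ne)
    have unmatched : {a ∈ insert s S | a < f s ∧ f s ≤ f a} = {a ∈ insert s S | a < f s} := by
      refine filter_congr fun a ha => and_iff_left_of_imp fun _ => ?_
      rcases mem_insert.mp ha with rfl | ha
      exacts [le_rfl, (hlt a ha).le]
    rw [unmatched_lt, unmatched]
  · simp [filter_insert, (hlt b hb).not_gt, (hlt b hb).not_ge]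

theorem isRankMatching_insert_iff {s t : α} (ht : ∀ t' ∈ T, t < t') (hs : s ∈ S) (hf : f s = t) :
    IsRankMatching κ S (insert t T) f ↔
      s < t ∧ #{a ∈ S | a < s} = κ #{a ∈ S | a < t} ∧ IsRankMatching κ (S.erase s) T f := by
  obtain ⟨S, hsS, rfl⟩ : ∃ S', s ∉ S' ∧ insert s S' = S :=
    ⟨S.erase s, notMem_erase s S, insert_erase hs⟩
  subst hf
  have bijOn_iff : Set.BijOn f (insert s S : Finset α) (insert (f s) T : Finset α) ↔
      Set.BijOn f S T := by
    rw [coe_insert, coe_insert]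
    exact Set.BijOn.insert_iff (mod_cast hsS) fun h => lt_irrefl _ (ht _ h)
  have lt_apply (hST : Set.BijOn f S T) : ∀ a ∈ S, f s < f a := fun a ha => ht _ (hST.mapsTo ha)
  rw [erase_insert hsS]
  constructor
  · intro h
    have hST := bijOn_iff.mp h.bijOn
    obtain ⟨rank_s, rank⟩ := (rank_insert_iff (lt_apply hST)).mp h.rank
    exact ⟨h.lt_apply s hs, rank_s, hST, fun a ha => h.lt_apply a (mem_insert_of_mem ha), rank⟩
  · rintro ⟨hlt, rank_s, h⟩
    exact ⟨bijOn_iff.mpr h.bijOn, forall_mem_insert .. |>.mpr ⟨hlt, h.lt_apply⟩,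
      (rank_insert_iff (lt_apply h.bijOn)).mpr ⟨rank_s, h.rank⟩⟩

theorem IsRankMatching.eqOn (hf : IsRankMatching κ S T f) (hg : IsRankMatching κ S T g) :
    Set.EqOn f g S := by
  induction T using Finset.induction_on_min generalizing S with
  | empty =>
    intro s hs
    simpa using hf.bijOn.mapsTo hs
  | insert t T ht ih =>
    obtain ⟨s, hs, hfs⟩ := hf.bijOn.surjOn (mem_coe.mpr (mem_insert_self t T))
    obtain ⟨s', hs', hgs'⟩ := hg.bijOn.surjOn (mem_coe.mpr (mem_insert_self t T))
    obtain ⟨-, rank_f, hf'⟩ := (isRankMatching_insert_iff ht hs hfs).mp hf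
    obtain ⟨-, rank_g, hg'⟩ := (isRankMatching_insert_iff ht hs' hgs').mp hg
    obtain rfl : s = s' :=
      (strictMonoOn_card_filter_lt S).injOn hs hs' (rank_f.trans rank_g.symm)
    intro a ha
    rcases eq_or_ne a s with rfl | has
    · rw [hfs, hgs']
    · exact ih hf' hg' (mem_coe.mpr (mem_erase.mpr ⟨has, ha⟩))

theorem exists_isRankMatching (hκ : ∀ h, 0 < h → κ h < h) (hcard : #S = #T)
    (hdom : ∀ t ∈ T, #{t' ∈ T | t' ≤ t} ≤ #{s ∈ S | s < t}) :
    ∃ f : α → α, IsRankMatching κ S T f := by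
  induction T using Finset.induction_on_min generalizing S with
  | empty =>
    obtain rfl : S = ∅ := by simpa using hcard
    exact ⟨id, by simp, by simp, by simp⟩
  | insert t T ht ih =>
    have htT : t ∉ T := fun h => lt_irrefl t (ht t h)
    have available_pos : 0 < #{s ∈ S | s < t} :=
      (card_pos.mpr ⟨t, by simp⟩).trans_le (hdom t (mem_insert_self t T))
    obtain ⟨s, hs, rank_s⟩ := exists_card_filter_lt_eq (hκ _ available_pos)
    obtain ⟨hsS, hst⟩ := mem_filter.mp hs
    have filter_lt_s : {a ∈ S | a < t ∧ a < s} = {a ∈ S | a < s} :=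
      filter_congr fun a _ => and_iff_right_of_imp fun has => has.trans hst
    rw [filter_filter, filter_lt_s] at rank_s
    have hcard' : #(S.erase s) = #T := by
      rw [card_erase_of_mem hsS, hcard, card_insert_of_notMem htT, Nat.add_sub_cancel]
    have hdom' : ∀ t' ∈ T, #{u ∈ T | u ≤ t'} ≤ #{u ∈ S.erase s | u < t'} := by
      intro t' ht'
      have h := hdom t' (mem_insert_of_mem ht')
      rw [filter_insert, if_pos (ht t' ht').le, card_insert_of_notMem (by simp [htT])] at h
      rw [filter_erase, card_erase_of_mem (by simp [hsS, hst.trans (ht t' ht')])]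
      omega
    obtain ⟨f, hf⟩ := ih hcard' hdom'
    refine ⟨Function.update f s t, (isRankMatching_insert_iff ht hsS (by simp)).mpr
      ⟨hst, rank_s, hf.congr fun a ha => (Function.update_of_ne ?_ _ _).symm⟩⟩
    exact (mem_erase.mp ha).1

end RankMatchings

section Permutations

theorem leftInverse_piecewise {α : Type*} {f f' g g' : α → α} {A A' B B' : Set α}
    [∀ i, Decidable (i ∈ A)] [∀ i, Decidable (i ∈ A')] [∀ i, Decidable (i ∈ B)]
    [∀ i, Decidable (i ∈ B')] (hf : Set.MapsTo f A B) (hf' : Set.LeftInvOn f' f A)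
    (hg : Set.MapsTo g A' B') (hg' : Set.LeftInvOn g' g A') (hB : Disjoint B B')
    (hunion : A ∪ A' = B ∪ B') :
    Function.LeftInverse (B.piecewise f' (B'.piecewise g' id))
      (A.piecewise f (A'.piecewise g id)) := by
  intro i
  by_cases hA : i ∈ A
  · simp [hA, hf hA, hf' hA]
  by_cases hA' : i ∈ A'
  · simp [hA, hA', hg hA', hg' hA', Set.disjoint_right.mp hB (hg hA')]
  · have hi : i ∉ B ∪ B' := hunion ▸ fun h => h.elim hA hA'
    rw [Set.mem_union, not_or] at hi
    simp [hA, hA', hi]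

theorem exists_perm_eqOn {α : Type*} {f g : α → α} {A A' B B' : Set α} (hf : Set.BijOn f A B)
    (hg : Set.BijOn g B' A') (hA : Disjoint A A') (hB : Disjoint B B')
    (hunion : A ∪ A' = B ∪ B') :
    ∃ π : Equiv.Perm α, Set.EqOn π f A ∧ Set.EqOn π.symm g B' ∧ ∀ i ∉ A ∪ A', π i = i := by
  classical
  cases isEmpty_or_nonempty α
  · exact ⟨1, fun i => isEmptyElim i, fun i => isEmptyElim i, fun i => isEmptyElim i⟩
  have hf' := hf.invOn_invFunOn
  have hg' := hg.invOn_invFunOn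
  refine ⟨⟨A.piecewise f (A'.piecewise (Function.invFunOn g B') id),
    B.piecewise (Function.invFunOn f A) (B'.piecewise g id),
    leftInverse_piecewise hf.mapsTo hf'.1 hg.surjOn.mapsTo_invFunOn hg'.2 hB hunion,
    leftInverse_piecewise hf.surjOn.mapsTo_invFunOn hf'.2 hg.mapsTo hg'.1 hA hunion.symm⟩, ?_⟩
  refine ⟨fun i hi => by simp [hi], fun i hi => ?_, fun i hi => ?_⟩
  · simp [Set.disjoint_right.mp hB hi, hi]
  · rw [Set.mem_union, not_or] at hi
    simp [hi]

theorem symm_apply_eq_self_iff {α : Type*} {π : Equiv.Perm α} {i : α} :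
    π.symm i = i ↔ π i = i := by
  rw [Equiv.symm_apply_eq, eq_comm]

section LinearOrder

variable {α : Type*} [LinearOrder α] {π σ : Equiv.Perm α} {i : α}

/-- The local shape of `π` at `i`. -/
def cycleShape (π : Equiv.Perm α) (i : α) : CycleShape :=
  if i < π i then if i < π.symm i then .valley else .doubleRise
  else if π i < i then if i < π.symm i then .doubleFall else .peak
  else .fixedPoint

theorem lt_apply_iff_cycleShape :
    i < π i ↔ cycleShape π i ∈ ({.valley, .doubleRise} : Finset CycleShape) := by
  unfold cycleShape
  split_ifs <;> simp_all

theorem apply_lt_iff_cycleShape :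
    π i < i ↔ cycleShape π i ∈ ({.peak, .doubleFall} : Finset CycleShape) := by
  unfold cycleShape
  split_ifs with h1 h2 h3
  · simp [h1.not_gt]
  · simp [h1.not_gt]
  all_goals simp [*]

theorem lt_symm_apply_iff_cycleShape :
    i < π.symm i ↔ cycleShape π i ∈ ({.valley, .doubleFall} : Finset CycleShape) := by
  unfold cycleShape
  split_ifs with h1 h2 h3 h4
  iterate 4 simp [*]
  have hfix : π i = i := le_antisymm (not_lt.mp h1) (not_lt.mp h3)
  simp [symm_apply_eq_self_iff.mpr hfix]

theorem symm_apply_lt_iff_cycleShape :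
    π.symm i < i ↔ cycleShape π i ∈ ({.peak, .doubleRise} : Finset CycleShape) := by
  have hfix : π.symm i = i ↔ π i = i := symm_apply_eq_self_iff
  unfold cycleShape
  split_ifs with h1 h2 h3 h4
  · simp [h2.not_gt]
  · simp [lt_iff_le_and_ne, not_lt.mp h2, hfix, h1.ne']
  · simp [h4.not_gt]
  · simp [lt_iff_le_and_ne, not_lt.mp h4, hfix, h3.ne]
  · simp [hfix.mpr (le_antisymm (not_lt.mp h1) (not_lt.mp h3))]

theorem apply_eq_self_iff_cycleShape : π i = i ↔ cycleShape π i = .fixedPoint := by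
  unfold cycleShape
  split_ifs with h1 h2 h3 h4
  · simp [h1.ne']
  · simp [h1.ne']
  · simp [h3.ne]
  · simp [h3.ne]
  · simp [le_antisymm (not_lt.mp h1) (not_lt.mp h3)]

theorem cycleShape_eq_of_forall {s : CycleShape}
    (hup : s ∈ ({.valley, .doubleRise} : Finset CycleShape) → i < π i)
    (hdown : s ∈ ({.peak, .doubleFall} : Finset CycleShape) → π i < i)
    (hup_symm : s ∈ ({.valley, .doubleFall} : Finset CycleShape) → i < π.symm i)
    (hdown_symm : s ∈ ({.peak, .doubleRise} : Finset CycleShape) → π.symm i < i)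
    (hfix : s = .fixedPoint → π i = i) : cycleShape π i = s := by
  unfold cycleShape
  cases s with
  | fixedPoint => simp [hfix rfl]
  | valley => rw [if_pos (hup (by decide)), if_pos (hup_symm (by decide))]
  | doubleRise => rw [if_pos (hup (by decide)), if_neg (hdown_symm (by decide)).not_gt]
  | doubleFall =>
    have h := hdown (by decide)
    rw [if_neg h.not_gt, if_pos h, if_pos (hup_symm (by decide))]
  | peak =>
    have h := hdown (by decide)
    rw [if_neg h.not_gt, if_pos h, if_neg (hdown_symm (by decide)).not_gt]

theorem rise_cycleShape :
    (cycleShape π i).rise = (if i < π i then 1 else 0) - if π.symm i < i then 1 else 0 := by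
  simp only [lt_apply_iff_cycleShape, symm_apply_lt_iff_cycleShape]
  cases cycleShape π i <;> rfl

theorem rise_cycleShape_symm : (cycleShape π.symm i).rise = (cycleShape π i).rise := by
  rw [rise_cycleShape, Equiv.symm_symm]
  simp only [lt_symm_apply_iff_cycleShape, apply_lt_iff_cycleShape]
  cases cycleShape π i <;> rfl

variable [Fintype α] {κ : ℕ → ℕ}

/-- Every excedance value `π s` is taken at the position of rank `κ h`, ranks starting from `0`,
among the `h` positions `a < π s` with `π a ≥ π s`. -/
def RankMatchedExcedances (κ : ℕ → ℕ) (π : Equiv.Perm α) : Prop :=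
  ∀ s, s < π s → #{a | a < s ∧ π s < π a} = κ #{a | a < π s ∧ π s ≤ π a}

/-- Both `π` and `π⁻¹` have rank matched excedances. -/
def RankMatched (κ : ℕ → ℕ) (π : Equiv.Perm α) : Prop :=
  RankMatchedExcedances κ π ∧ RankMatchedExcedances κ π.symm

theorem rankMatchedExcedances_iff_isRankMatching :
    RankMatchedExcedances κ π ↔ IsRankMatching κ {i | i < π i} {i | π.symm i < i} π := by
  have filter_eq {s : α} (hs : s < π s) :
      ({a ∈ {i | i < π i} | a < s ∧ π s < π a} : Finset α) = ({a | a < s ∧ π s < π a} : Finset α) ∧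
      ({a ∈ {i | i < π i} | a < π s ∧ π s ≤ π a} : Finset α) =
        ({a | a < π s ∧ π s ≤ π a} : Finset α) := by
    simp only [filter_filter]
    exact ⟨filter_congr fun a _ => and_iff_right_of_imp fun h => h.1.trans (hs.trans h.2),
      filter_congr fun a _ => and_iff_right_of_imp fun h => h.1.trans_le h.2⟩
  constructor
  · refine fun h => ⟨?_, by simp, fun s hs => ?_⟩
    · refine ⟨fun i => by simp, π.injective.injOn, fun i hi => ⟨π.symm i, by simpa using hi⟩⟩
    · have hs' : s < π s := by simpa using hs
      rw [(filter_eq hs').1, (filter_eq hs').2]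
      exact h s hs'
  · intro h s hs
    rw [← (filter_eq hs).1, ← (filter_eq hs).2]
    exact h.rank s (by simpa using hs)

theorem rankMatched_iff_isRankMatching :
    RankMatched κ π ↔
      IsRankMatching κ {i | cycleShape π i ∈ ({.valley, .doubleRise} : Finset CycleShape)}
        {i | cycleShape π i ∈ ({.peak, .doubleRise} : Finset CycleShape)} π ∧
      IsRankMatching κ {i | cycleShape π i ∈ ({.valley, .doubleFall} : Finset CycleShape)}
        {i | cycleShape π i ∈ ({.peak, .doubleFall} : Finset CycleShape)} π.symm := by
  rw [RankMatched, rankMatchedExcedances_iff_isRankMatching,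
    rankMatchedExcedances_iff_isRankMatching, Equiv.symm_symm]
  simp only [lt_apply_iff_cycleShape (π := π), apply_lt_iff_cycleShape (π := π),
    lt_symm_apply_iff_cycleShape (π := π), symm_apply_lt_iff_cycleShape (π := π)]

theorem cycleShape_eq_of_isRankMatching {w : α → CycleShape}
    (hup : IsRankMatching κ {i | w i ∈ ({.valley, .doubleRise} : Finset CycleShape)}
      {i | w i ∈ ({.peak, .doubleRise} : Finset CycleShape)} π)
    (hdown : IsRankMatching κ {i | w i ∈ ({.valley, .doubleFall} : Finset CycleShape)}
      {i | w i ∈ ({.peak, .doubleFall} : Finset CycleShape)} π.symm)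
    (hfix : ∀ i, w i = .fixedPoint → π i = i) : cycleShape π = w := by
  ext i
  refine cycleShape_eq_of_forall (fun hi => hup.lt_apply i (by simpa using hi)) (fun hi => ?_)
    (fun hi => hdown.lt_apply i (by simpa using hi)) (fun hi => ?_) (hfix i)
  · obtain ⟨j, hj, rfl⟩ := hdown.bijOn.surjOn (by simpa using hi)
    rw [Equiv.apply_symm_apply]
    exact hdown.lt_apply j hj
  · obtain ⟨j, hj, rfl⟩ := hup.bijOn.surjOn (by simpa using hi)
    rw [Equiv.symm_apply_apply]
    exact hup.lt_apply j hj

theorem RankMatched.eq_of_cycleShape_eq (hπ : RankMatched κ π) (hσ : RankMatched κ σ)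
    (h : cycleShape π = cycleShape σ) : π = σ := by
  rw [rankMatched_iff_isRankMatching] at hπ hσ
  rw [h] at hπ
  have up := hπ.1.eqOn hσ.1
  have down := hπ.2.eqOn hσ.2
  rw [← h] at up down
  simp only [← lt_apply_iff_cycleShape, ← lt_symm_apply_iff_cycleShape] at up down
  ext i
  rcases lt_trichotomy i (π i) with hi | hi | hi
  · exact up (by simpa using hi)
  · rw [eq_comm, apply_eq_self_iff_cycleShape, h, ← apply_eq_self_iff_cycleShape] at hi
    rw [hi, apply_eq_self_iff_cycleShape, h, ← apply_eq_self_iff_cycleShape]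
    exact hi
  · have hdown := down (x := π i) (by simpa using hi)
    rw [Equiv.symm_apply_apply, eq_comm, Equiv.symm_apply_eq] at hdown
    exact hdown

end LinearOrder

section Fin

variable {n : ℕ}

/-- The number of excedance arcs `a ↦ π a` with `a < k ≤ π a`. -/
def openArcCount (π : Equiv.Perm (Fin n)) (k : ℕ) : ℕ :=
  #{a : Fin n | (a : ℕ) < k ∧ k ≤ π a}

theorem pathHeight_cycleShape (π : Equiv.Perm (Fin n)) (k : ℕ) :
    pathHeight (cycleShape π) k = openArcCount π k := by
  have pathHeight_eq : pathHeight (cycleShape π) k =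
      (∑ j : Fin n, if (j : ℕ) < k ∧ j < π j then (1 : ℤ) else 0) -
        ∑ j : Fin n, if (j : ℕ) < k ∧ π.symm j < j then (1 : ℤ) else 0 := by
    rw [pathHeight, ← sum_sub_distrib]
    refine sum_congr rfl fun j _ => ?_
    rw [rise_cycleShape]
    by_cases h : (j : ℕ) < k <;> simp [h]
  rw [pathHeight_eq, ← Equiv.sum_comp π fun j => if (j : ℕ) < k ∧ π.symm j < j then (1 : ℤ) else 0,
    ← sum_sub_distrib, openArcCount, card_filter, Nat.cast_sum]
  refine sum_congr rfl fun j _ => ?_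
  simp only [Equiv.symm_apply_apply, Fin.lt_def]
  push_cast
  split_ifs <;> omega

theorem openArcCount_symm (π : Equiv.Perm (Fin n)) (k : ℕ) :
    openArcCount π.symm k = openArcCount π k := by
  have h : pathHeight (cycleShape π.symm) k = pathHeight (cycleShape π) k := by
    simp only [pathHeight, rise_cycleShape_symm]
  rw [pathHeight_cycleShape, pathHeight_cycleShape] at h
  exact_mod_cast h

/-- `w` is the step sequence of a path from height `0` to height `0` whose steps at height `0` are
fixed points or valleys. -/
def IsShapePath (w : Fin n → CycleShape) : Prop :=
  (∀ i, w i ∈ ({.peak, .doubleRise, .doubleFall} : Finset CycleShape) → 1 ≤ pathHeight w i) ∧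
    pathHeight w n = 0

theorem isShapePath_cycleShape (π : Equiv.Perm (Fin n)) : IsShapePath (cycleShape π) := by
  refine ⟨fun i hi => ?_, by rw [pathHeight_cycleShape, openArcCount]; simp⟩
  have arc : ∃ τ : Equiv.Perm (Fin n), τ.symm i < i ∧ openArcCount τ i = openArcCount π i := by
    rcases em (π.symm i < i) with h | h
    · exact ⟨π, h, rfl⟩
    · refine ⟨π.symm, ?_, openArcCount_symm π i⟩
      rw [symm_apply_lt_iff_cycleShape] at h
      rw [Equiv.symm_symm, apply_lt_iff_cycleShape]
      revert hi h
      cases cycleShape π i <;> decide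
  obtain ⟨τ, hτ, h_eq⟩ := arc
  rw [pathHeight_cycleShape, ← h_eq, Nat.one_le_cast, Nat.one_le_iff_ne_zero, openArcCount]
  exact card_ne_zero.mpr ⟨τ.symm i, by simpa using hτ⟩

variable {κ : ℕ → ℕ} {w : Fin n → CycleShape}

theorem pathHeight_eq_sub {A B : Finset CycleShape}
    (hAB : ∀ s, s.rise = (if s ∈ A then 1 else 0) - if s ∈ B then 1 else 0) (k : ℕ) :
    pathHeight w k = (#{i : Fin n | w i ∈ A ∧ (i : ℕ) < k} : ℤ) -
      #{i : Fin n | w i ∈ B ∧ (i : ℕ) < k} := by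
  rw [pathHeight, card_filter, card_filter, Nat.cast_sum, Nat.cast_sum, ← sum_sub_distrib]
  refine sum_congr rfl fun j _ => ?_
  rw [hAB]
  by_cases h : (j : ℕ) < k <;> simp [h]

theorem IsShapePath.exists_isRankMatching (hw : IsShapePath w) (hκ : ∀ h, 0 < h → κ h < h)
    {A B : Finset CycleShape} (hB : B ⊆ {.peak, .doubleRise, .doubleFall})
    (hAB : ∀ s, s.rise = (if s ∈ A then 1 else 0) - if s ∈ B then 1 else 0) :
    ∃ f, IsRankMatching κ ({i | w i ∈ A} : Finset (Fin n)) {i | w i ∈ B} f := by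
  refine _root_.exists_isRankMatching hκ ?_ fun t ht => ?_
  · have h := pathHeight_eq_sub (w := w) hAB n
    rw [hw.2] at h
    simp only [Fin.is_lt, and_true] at h
    omega
  · have ht' : w t ∈ B := by simpa using ht
    have h := hw.1 t (hB ht')
    rw [pathHeight_eq_sub hAB] at h
    have filter_le : ({i ∈ {i | w i ∈ B} | i ≤ t} : Finset (Fin n)) =
        insert t ({i | w i ∈ B ∧ (i : ℕ) < t} : Finset (Fin n)) := by
      ext a
      simp only [mem_filter, mem_univ, true_and, mem_insert, le_iff_eq_or_lt, Fin.lt_def]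
      constructor
      · rintro ⟨ha, h | h⟩
        exacts [Or.inl h, Or.inr ⟨ha, h⟩]
      · rintro (rfl | h)
        exacts [⟨ht', Or.inl rfl⟩, ⟨h.1, Or.inr h.2⟩]
    rw [filter_le, card_insert_of_notMem (by simp), filter_filter]
    simp only [Fin.lt_def]
    omega

theorem IsShapePath.exists_rankMatched (hw : IsShapePath w) (hκ : ∀ h, 0 < h → κ h < h) :
    ∃ π : Equiv.Perm (Fin n), RankMatched κ π ∧ cycleShape π = w := by
  obtain ⟨f, hf⟩ := hw.exists_isRankMatching hκ (A := {.valley, .doubleRise})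
    (B := {.peak, .doubleRise}) (by decide) (by decide)
  obtain ⟨g, hg⟩ := hw.exists_isRankMatching hκ (A := {.valley, .doubleFall})
    (B := {.peak, .doubleFall}) (by decide) (by decide)
  have bijOn_f := hf.bijOn
  have bijOn_g := hg.bijOn
  simp only [coe_filter, mem_univ, true_and] at bijOn_f bijOn_g
  have disjoint {A B : Finset CycleShape} (h : Disjoint A B) :
      Disjoint {i | w i ∈ A} {i | w i ∈ B} :=
    Set.disjoint_left.mpr fun i hA hB => Finset.disjoint_left.mp h hA hB
  have union_eq : ∀ s : CycleShape,
      s ∈ ({.valley, .doubleRise} : Finset CycleShape) ∨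
        s ∈ ({.peak, .doubleFall} : Finset CycleShape) ↔
      s ∈ ({.peak, .doubleRise} : Finset CycleShape) ∨
        s ∈ ({.valley, .doubleFall} : Finset CycleShape) := by decide
  obtain ⟨π, hπf, hπg, hπ⟩ := exists_perm_eqOn bijOn_f bijOn_g (disjoint (by decide))
    (disjoint (by decide)) (Set.ext fun i => union_eq (w i))
  have hup := hf.congr fun i hi => (hπf (by simpa using hi)).symm
  have hdown := hg.congr fun i hi => (hπg (by simpa using hi)).symm
  have hshape : cycleShape π = w :=
    cycleShape_eq_of_isRankMatching hup hdown fun i hi => hπ i (by simp [hi])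
  refine ⟨π, ?_, hshape⟩
  rw [rankMatched_iff_isRankMatching, hshape]
  exact ⟨hup, hdown⟩

theorem bijOn_cycleShape (hκ : ∀ h, 0 < h → κ h < h) :
    Set.BijOn cycleShape {π : Equiv.Perm (Fin n) | RankMatched κ π} {w | IsShapePath w} :=
  ⟨fun π _ => isShapePath_cycleShape π, fun _ hπ _ hσ => hπ.eq_of_cycleShape_eq hσ,
    fun _ hw => IsShapePath.exists_rankMatched hw hκ⟩

end Fin

end Permutations

section Weights

variable {n : ℕ} (π : Equiv.Perm (Fin n))

theorem openArcCount_val (i : Fin n) : openArcCount π i = #{a | a < i ∧ i ≤ π a} := by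
  simp [openArcCount]

theorem sum_openArcCount : ∑ i : Fin n, openArcCount π i = ∑ b : Fin n, ((b : ℕ) - π b) := by
  simp only [← openArcCount_symm π, openArcCount_val, card_filter]
  rw [sum_comm, ← Equiv.sum_comp π]
  refine sum_congr rfl fun b _ => ?_
  rw [← card_filter, Equiv.symm_apply_apply, ← Fin.card_Ioc]
  congr 1
  ext i
  simp

theorem card_inversions_left_add_apply (b : Fin n) :
    #{a | a < b ∧ π b < π a} + (π b : ℕ) = #{a | b < a ∧ π a < π b} + (b : ℕ) := by
  have card_left : #{a | a < b ∧ π b < π a} + #{a | a < b ∧ π a < π b} = (b : ℕ) := by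
    rw [← Fin.card_Iio b, ← card_union_of_disjoint (disjoint_filter.mpr (by omega))]
    congr 1
    ext a
    have : π a = π b → a = b := fun h => π.injective h
    simp only [mem_union, mem_filter, mem_univ, true_and, mem_Iio]
    omega
  have card_below : #{a | b < a ∧ π a < π b} + #{a | a < b ∧ π a < π b} = (π b : ℕ) := by
    rw [← Fin.card_Iio (π b), ← card_map (s := Iio (π b)) π.symm.toEmbedding,
      ← card_union_of_disjoint (disjoint_filter.mpr (by omega))]
    congr 1
    ext a
    have : a = b → π a = π b := fun h => congrArg π h
    simp only [mem_union, mem_filter, mem_univ, true_and, mem_map_equiv, Equiv.symm_symm, mem_Iio]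
    omega
  omega

theorem card_inversions_left_eq (b : Fin n) :
    #{a | a < b ∧ π b < π a} = ((b : ℕ) - π b) + (if π b = b then openArcCount π b else 0) +
      (if b < π b then #{a | a < b ∧ π b < π a} else 0) +
      if π b < b then #{a | b < a ∧ π a < π b} else 0 := by
  have h := card_inversions_left_add_apply π b
  rcases lt_trichotomy (π b) b with hlt | heq | hgt
  · rw [if_neg hlt.ne, if_neg hlt.not_gt, if_pos hlt]
    omega
  · have card_eq : #{a | a < b ∧ π b < π a} = openArcCount π b := by
      rw [openArcCount_val]
      congr 1
      ext a
      have : π a = π b → a = b := fun h => π.injective h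
      simp only [mem_filter, mem_univ, true_and]
      omega
    simp [heq, ← card_eq]
  · rw [if_neg hgt.ne', if_pos hgt, if_neg hgt.not_gt]
    omega

theorem sum_deficiencies_card_inversions_right :
    (∑ b, if π b < b then #{a | b < a ∧ π a < π b} else 0) =
      ∑ s, if s < π.symm s then #{a | a < s ∧ π.symm s < π.symm a} else 0 := by
  rw [← Equiv.sum_comp π fun s => if s < π.symm s then _ else _]
  refine sum_congr rfl fun b _ => ?_
  rw [Equiv.symm_apply_apply, ← card_map π.toEmbedding]
  congr 2
  ext a
  simp [mem_map_equiv, and_comm]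

theorem invCount_eq_sum :
    invCount π = ∑ i : Fin n, (openArcCount π i + (if π i = i then openArcCount π i else 0)) +
      (∑ s, if s < π s then #{a | a < s ∧ π s < π a} else 0) +
      ∑ s, if s < π.symm s then #{a | a < s ∧ π.symm s < π.symm a} else 0 := by
  have invCount_eq : invCount π = ∑ b, #{a | a < b ∧ π b < π a} := by
    simp only [invCount, card_filter]
    rw [Fintype.sum_prod_type, sum_comm]
  rw [invCount_eq, ← sum_deficiencies_card_inversions_right, sum_add_distrib, sum_openArcCount,
    ← sum_add_distrib, ← sum_add_distrib, ← sum_add_distrib]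
  exact sum_congr rfl fun b _ => card_inversions_left_eq π b

/-- The contribution to the inversion number of a step at height `h`. -/
def stepInv (κ : ℕ → ℕ) (h : ℕ) : CycleShape → ℕ
  | .fixedPoint => 2 * h
  | .valley => h
  | .doubleRise => h + κ h
  | .doubleFall => h + κ h
  | .peak => h + 2 * κ h

variable {π} {κ : ℕ → ℕ}

theorem RankMatchedExcedances.sum_card_eq (hπ : RankMatchedExcedances κ π) :
    (∑ s, if s < π s then #{a | a < s ∧ π s < π a} else 0) =
      ∑ t : Fin n, if π.symm t < t then κ (openArcCount π t) else 0 := by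
  rw [← Equiv.sum_comp π fun t : Fin n => if π.symm t < t then κ (openArcCount π t) else 0]
  refine sum_congr rfl fun s _ => ?_
  rw [Equiv.symm_apply_apply]
  split_ifs with h
  · rw [hπ s h, openArcCount_val]
  · rfl

theorem RankMatched.invCount_eq (hπ : RankMatched κ π) :
    invCount π = ∑ i : Fin n, stepInv κ (openArcCount π i) (cycleShape π i) := by
  rw [invCount_eq_sum, hπ.1.sum_card_eq, hπ.2.sum_card_eq, ← sum_add_distrib, ← sum_add_distrib]
  refine sum_congr rfl fun i _ => ?_
  rw [openArcCount_symm, Equiv.symm_symm]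
  simp only [apply_eq_self_iff_cycleShape (π := π), apply_lt_iff_cycleShape (π := π),
    symm_apply_lt_iff_cycleShape (π := π)]
  cases cycleShape π i <;>
    simp only [reduceCtorEq, ↓reduceIte, mem_insert, mem_singleton, or_self, or_true, or_false,
      add_zero, stepInv] <;>
    omega

/-- Number of cycle valleys `i < π(i)`, `i < π⁻¹(i)`. -/
def valleyCount (π : Equiv.Perm (Fin n)) : ℕ := #{i | i < π i ∧ i < π.symm i}

variable {R : Type*} [CommRing R]

/-- The part of the weight of a step that does not depend on its height: `x` marks fixed points,
`v` excedances, `w` double excedances and `s` cycle valleys. -/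
def stepLabel (x v w s : R) : CycleShape → R
  | .fixedPoint => x
  | .valley => v * s
  | .doubleRise => v * w
  | .doubleFall => 1
  | .peak => 1

theorem prod_stepLabel_cycleShape (x v w s : R) (π : Equiv.Perm (Fin n)) :
    ∏ i, stepLabel x v w s (cycleShape π i) =
      x ^ fpCount π * v ^ excCount π * w ^ dexcCount π * s ^ valleyCount π := by
  have dexcCount_eq : dexcCount π = #{i | π.symm i < i ∧ i < π i} := by
    rw [dexcCount, ← card_map π.toEmbedding]
    congr 1
    ext i
    simp [mem_map_equiv]
  simp only [dexcCount_eq, fpCount, excCount, valleyCount, card_filter, ← prod_pow_eq_pow_sum,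
    ← prod_mul_distrib, apply_eq_self_iff_cycleShape (π := π), lt_apply_iff_cycleShape (π := π),
    lt_symm_apply_iff_cycleShape (π := π), symm_apply_lt_iff_cycleShape (π := π)]
  refine prod_congr rfl fun i _ => ?_
  cases cycleShape π i <;> simp [stepLabel]

/-- The weight of a step at height `h`; it vanishes for the steps that `IsShapePath` excludes. -/
def stepWeight (κ : ℕ → ℕ) (x v w s q : R) (h : ℕ) (c : CycleShape) : R :=
  if h = 0 ∧ c ∈ ({.peak, .doubleRise, .doubleFall} : Finset CycleShape) then 0
  else stepLabel x v w s c * q ^ stepInv κ h c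

open Classical in
theorem pathSum_stepWeight (κ : ℕ → ℕ) (x v w s q : R) (n : ℕ) :
    pathSum (stepWeight κ x v w s q) n 0 = ∑ p : Fin n → CycleShape with IsShapePath p,
      (∏ i, stepLabel x v w s (p i)) * q ^ ∑ i : Fin n, stepInv κ (pathHeight p i).toNat (p i) := by
  simp only [pathSum, sum_filter, Nat.cast_zero, zero_add]
  refine sum_congr rfl fun p _ => ?_
  by_cases hp : IsShapePath p
  · rw [if_pos hp, if_pos hp.2, ← prod_pow_eq_pow_sum, ← prod_mul_distrib]
    refine prod_congr rfl fun i _ => if_neg fun hi => ?_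
    have := hp.1 i hi.2
    omega
  · rw [if_neg hp, ite_eq_right_iff]
    intro hlast
    obtain ⟨i, hi, hi0⟩ : ∃ i, p i ∈ ({.peak, .doubleRise, .doubleFall} : Finset CycleShape) ∧
        pathHeight p i < 1 := by
      by_contra! h
      exact hp ⟨h, hlast⟩
    exact prod_eq_zero (mem_univ i) (if_pos ⟨by omega, hi⟩)

theorem permGF_rankMatched (hκ : ∀ h, 0 < h → κ h < h) (x v w s q : R) :
    permGF (fun _ π => RankMatched κ π)
        (fun _ π => x ^ fpCount π * v ^ excCount π * w ^ dexcCount π * s ^ valleyCount π *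
          q ^ invCount π) =
      jFraction (fun h => v * s * q ^ (2 * h - 1 + 2 * κ h))
        (fun h => if h = 0 then x else x * q ^ (2 * h) + (1 + v * w) * q ^ (h + κ h)) := by
  classical
  ext n
  rw [coeff_jFraction_eq_pathSum (ω := stepWeight κ x v w s q), pathSum_stepWeight, permGF,
    coeff_mk]
  · have bij := bijOn_cycleShape (n := n) hκ
    refine sum_nbij cycleShape (fun π hπ => ?_) ?_ ?_ fun π hπ => ?_
    · simpa using bij.mapsTo (by simpa using hπ)
    · simpa using bij.injOn
    · simpa using bij.surjOn
    · have hπ' : RankMatched κ π := by simpa using hπ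
      simp only [prod_stepLabel_cycleShape, pathHeight_cycleShape, Int.toNat_natCast,
        hπ'.invCount_eq]
  · simp [stepWeight]
  · intro h
    have exponent : 2 * (h + 1) - 1 + 2 * κ (h + 1) = h + (h + 1 + 2 * κ (h + 1)) := by omega
    simp [stepWeight, stepLabel, stepInv, exponent, pow_add, mul_assoc]
  · rintro (_ | h)
    · simp [stepWeight, stepLabel, stepInv]
    · simp only [stepWeight, stepLabel, stepInv, Nat.add_eq_zero_iff, one_ne_zero, and_false,
        ↓reduceIte, mem_insert, mem_singleton, reduceCtorEq, or_self, or_false, or_true, and_self,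
        and_true, one_mul]
      ring

end Weights

section IncreasingArcs

variable {n : ℕ}

theorem rankMatchedExcedances_zero_iff (π : Equiv.Perm (Fin n)) :
    RankMatchedExcedances (fun _ => 0) π ↔ IncreasingExcedances π := by
  simp only [RankMatchedExcedances, IncreasingExcedances, card_eq_zero, filter_eq_empty_iff,
    mem_univ, true_implies, not_and, not_lt]
  constructor
  · intro h i j hij _ hj
    exact lt_of_le_of_ne (h j hj hij) fun he => hij.ne (π.injective he)
  · intro h s hs a ha
    by_contra! hlt
    exact (h a s ha (ha.trans (hs.trans hlt)) hs).not_gt hlt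

theorem increasingDeficiencies_iff (π : Equiv.Perm (Fin n)) :
    IncreasingDeficiencies π ↔ IncreasingExcedances π.symm := by
  constructor
  · intro h i j hij hi hj
    by_contra! hle
    have hlt : π.symm j < π.symm i := hle.lt_of_ne fun he => hij.ne' (π.symm.injective he)
    have := h _ _ hlt (by simpa using hj) (by simpa using hi)
    rw [Equiv.apply_symm_apply, Equiv.apply_symm_apply] at this
    exact this.not_gt hij
  · intro h i j hij hi hj
    by_contra! hle
    have hlt : π j < π i := hle.lt_of_ne fun he => hij.ne' (π.injective he)
    have := h _ _ hlt (by simpa using hj) (by simpa using hi)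
    rw [Equiv.symm_apply_apply, Equiv.symm_apply_apply] at this
    exact this.not_gt hij

theorem rankMatched_zero_iff (π : Equiv.Perm (Fin n)) :
    RankMatched (fun _ => 0) π ↔ IncreasingExcedances π ∧ IncreasingDeficiencies π := by
  rw [RankMatched, rankMatchedExcedances_zero_iff, rankMatchedExcedances_zero_iff,
    increasingDeficiencies_iff]

end IncreasingArcs

section NoncrossingArcs

theorem minimalPeriod_pos {α : Type*} [Finite α] (π : Equiv.Perm α) (a : α) :
    0 < Function.minimalPeriod π a :=
  Function.minimalPeriod_pos_of_mem_periodicPts (π.injective.mem_periodicPts a)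

theorem mem_of_sameCycle_of_mapsTo {α : Type*} [Finite α] {π : Equiv.Perm α} {S : Set α}
    (hS : Set.MapsTo π S S) {j k : α} (hjk : π.SameCycle j k) (hj : j ∈ S) : k ∈ S := by
  obtain ⟨m, rfl⟩ := hjk.exists_nat_pow_eq
  exact hS.perm_pow m hj

section LinearOrder

variable {α : Type*} [LinearOrder α] {π : Equiv.Perm α} {v : α}

/-- No two excedance arcs `i ↦ π i`, drawn above a line, cross. -/
def NoncrossingExcedances (π : Equiv.Perm α) : Prop :=
  ∀ i j, i < j → j < π i → π j < π i

theorem rankMatchedExcedances_pred_iff [Fintype α] :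
    RankMatchedExcedances (fun h => h - 1) π ↔ NoncrossingExcedances π := by
  have rank_eq_iff {s : α} (hs : s < π s) :
      #{a | a < s ∧ π s < π a} = #{a | a < π s ∧ π s ≤ π a} - 1 ↔
        ∀ a, s < a → a < π s → π a < π s := by
    have open_arcs_eq : ({a | a < π s ∧ π s ≤ π a} : Finset α) =
        insert s (({a | a < s ∧ π s < π a} : Finset α) ∪
          ({a | (s < a ∧ a < π s) ∧ π s < π a} : Finset α)) := by
      ext a
      have := π.injective.eq_iff (a := s) (b := a)
      simp only [mem_insert, mem_union, mem_filter, mem_univ, true_and]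
      grind
    rw [open_arcs_eq, card_insert_of_notMem (by simp), card_union_of_disjoint,
      Nat.add_sub_cancel, left_eq_add, card_eq_zero, filter_eq_empty_iff]
    · simp only [mem_univ, true_implies, not_and, not_lt, and_imp]
      exact forall₃_congr fun a hsa _ => (π.injective.ne hsa.ne').le_iff_lt
    · exact disjoint_filter.mpr fun a _ h h' => h.1.asymm h'.1.1
  exact ⟨fun h i j hij hj => (rank_eq_iff (hij.trans hj)).mp (h i (hij.trans hj)) j hij hj,
    fun h s hs => (rank_eq_iff hs).mpr (h s)⟩

/-- The points below the end of every excedance arc that starts before `v` and ends at or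
after `v`. -/
def beneathArcs (π : Equiv.Perm α) (v : α) : Set α :=
  {j | ∀ i < v, v ≤ π i → j < π i}

theorem isLowerSet_beneathArcs : IsLowerSet (beneathArcs π v) :=
  fun _ _ hle hj i hi hvi => hle.trans_lt (hj i hi hvi)

theorem mem_beneathArcs_self (hv : v ≤ π.symm v) : v ∈ beneathArcs π v := by
  refine fun i hi hvi => lt_of_le_of_ne hvi ?_
  rintro rfl
  exact hi.not_ge (by simpa using hv)

theorem NoncrossingExcedances.mapsTo_beneathArcs (hπ : NoncrossingExcedances π)
    (hsub : beneathArcs π v ⊆ beneathArcs π.symm v) :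
    Set.MapsTo π (Set.Ici v ∩ beneathArcs π v) (Set.Ici v ∩ beneathArcs π v) := by
  rintro j ⟨hvj : v ≤ j, hj⟩
  refine ⟨?_, fun i hi hvi => hπ i j (hi.trans_le hvj) (hj i hi hvi)⟩
  by_contra! hlt
  simpa using hsub hj (π j) (not_le.mp hlt) (by simpa using hvj)

-- The arcs of `π` and of `π⁻¹` over `v` leave two intervals starting at `v`. The shorter one is
-- mapped into itself by one of the two permutations, hence by both since it is finite.
theorem NoncrossingExcedances.exists_invariant_ordConnected [Finite α]
    (hπ : NoncrossingExcedances π) (hπ' : NoncrossingExcedances π.symm) (hv : v ≤ π v)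
    (hv' : v ≤ π.symm v) :
    ∃ S : Set α, S.OrdConnected ∧ IsLeast S v ∧ ∀ j k, π.SameCycle j k → j ∈ S → k ∈ S := by
  have ordConnected (τ : Equiv.Perm α) : (Set.Ici v ∩ beneathArcs τ v).OrdConnected :=
    Set.ordConnected_Ici.inter isLowerSet_beneathArcs.ordConnected
  have isLeast {τ : Equiv.Perm α} (h : v ≤ τ.symm v) : IsLeast (Set.Ici v ∩ beneathArcs τ v) v :=
    ⟨⟨Set.self_mem_Ici, mem_beneathArcs_self h⟩, fun _ hj => hj.1⟩
  rcases (isLowerSet_beneathArcs (π := π) (v := v)).total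
    (isLowerSet_beneathArcs (π := π.symm) (v := v)) with hsub | hsub
  · exact ⟨_, ordConnected π, isLeast hv', fun j k hjk =>
      mem_of_sameCycle_of_mapsTo (hπ.mapsTo_beneathArcs hsub) hjk⟩
  · exact ⟨_, ordConnected π.symm, isLeast hv, fun j k hjk =>
      mem_of_sameCycle_of_mapsTo (hπ'.mapsTo_beneathArcs hsub) (Equiv.Perm.sameCycle_inv.mpr hjk)⟩

theorem exists_sameCycle_forall_le [Finite α] (π : Equiv.Perm α) (i : α) :
    ∃ a, π.SameCycle i a ∧ ∀ b, π.SameCycle a b → a ≤ b := by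
  obtain ⟨a, ha, hmin⟩ :=
    Set.exists_min_image {b | π.SameCycle i b} id (Set.toFinite _) ⟨i, .refl π i⟩
  exact ⟨a, ha, fun b hb => hmin b (ha.trans hb)⟩

theorem exists_strictMonoOn_strictAntiOn {s : ℕ → α} {k : ℕ} (hk : 0 < k)
    (hinj : Set.InjOn s (Set.Iio k))
    (hdesc : ∀ j, j + 2 < k → s (j + 1) < s j → s (j + 2) < s (j + 1)) :
    ∃ m < k, StrictMonoOn s (Set.Iic m) ∧ StrictAntiOn s (Set.Ico m k) := by
  classical
  have turn : ∃ m, m + 1 = k ∨ s (m + 1) < s m := ⟨k - 1, .inl (by omega)⟩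
  have turn_lt : Nat.find turn < k := by
    have := Nat.find_min' turn (m := k - 1) (.inl (by omega))
    omega
  refine ⟨Nat.find turn, turn_lt, ?_, ?_⟩
  · refine strictMonoOn_of_lt_add_one Set.ordConnected_Iic fun j _ _ hj => ?_
    rw [Set.mem_Iic] at hj
    have not_turn := Nat.find_min turn (Nat.lt_of_succ_le hj)
    push Not at not_turn
    refine lt_of_le_of_ne not_turn.2 fun heq => j.succ_ne_self.symm (hinj ?_ ?_ heq) <;>
      rw [Set.mem_Iio] <;> omega
  · have descent (j : ℕ) (hj : Nat.find turn ≤ j) (hj' : j + 1 < k) : s (j + 1) < s j := by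
      induction j, hj using Nat.le_induction with
      | base => exact (Nat.find_spec turn).resolve_left hj'.ne
      | succ j _ ih => exact hdesc j hj' (ih (by omega))
    exact strictAntiOn_of_add_one_lt Set.ordConnected_Ico fun j _ hj hj' => descent j hj.1 hj'.2

end LinearOrder

variable {n : ℕ} {π : Equiv.Perm (Fin n)}

theorem NoncrossingCycles.symm (hπ : NoncrossingCycles π) : NoncrossingCycles π.symm := by
  rintro ⟨i, j, k, l, hij, hjk, hkl, hik, hjl, hnot⟩
  exact hπ ⟨i, j, k, l, hij, hjk, hkl, Equiv.Perm.sameCycle_inv.mp hik,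
    Equiv.Perm.sameCycle_inv.mp hjl, mt Equiv.Perm.sameCycle_inv.mpr hnot⟩

theorem NoncrossingExcedances.noncrossingCycles (hπ : NoncrossingExcedances π)
    (hπ' : NoncrossingExcedances π.symm) : NoncrossingCycles π := by
  have exists_hull (i : Fin n) : ∃ a, π.SameCycle i a ∧ ∃ S : Set (Fin n), S.OrdConnected ∧
      IsLeast S a ∧ ∀ j k, π.SameCycle j k → j ∈ S → k ∈ S := by
    obtain ⟨a, hia, ha⟩ := exists_sameCycle_forall_le π i
    exact ⟨a, hia, hπ.exists_invariant_ordConnected hπ' (ha _ (by simp [Equiv.Perm.SameCycle.refl]))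
      (ha _ (by simp [Equiv.Perm.SameCycle.refl]))⟩
  rintro ⟨i, j, k, l, hij, hjk, hkl, hik, hjl, hnot⟩
  obtain ⟨a, hia, S, hS, haS, hS_inv⟩ := exists_hull i
  obtain ⟨b, hjb, T, hT, hbT, hT_inv⟩ := exists_hull j
  have hiS : i ∈ S := hS_inv a i hia.symm haS.1
  have hjT : j ∈ T := hT_inv b j hjb.symm hbT.1
  have hjS : j ∈ S := hS.out hiS (hS_inv i k hik hiS) ⟨hij.le, hjk.le⟩
  have hkT : k ∈ T := hT.out hjT (hT_inv j l hjl hjT) ⟨hjk.le, hkl.le⟩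
  have hab : a ≤ b := haS.2 (hS_inv j b hjb hjS)
  have hba : b ≤ a := hbT.2 (hT_inv k a (hik.symm.trans hia) hkT)
  obtain rfl := le_antisymm hab hba
  exact hnot (hia.trans hjb.symm)

theorem UnimodalCycles.exists_excedance_run (hπ : UnimodalCycles π) (i : Fin n) :
    ∃ (s : ℕ → Fin n) (m : ℕ), StrictMonoOn s (Set.Iic m) ∧ (∀ p, π (s p) = s (p + 1)) ∧
      ∀ j, π.SameCycle i j → s 0 ≤ j ∧ (j < π j → ∃ p < m, s p = j) := by
  obtain ⟨a, hia, ha⟩ := exists_sameCycle_forall_le π i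
  obtain ⟨m, -, hmono, hanti⟩ := hπ a ha
  set k := Function.minimalPeriod π a with hk
  have pow_period : (π ^ k) a = a := by
    rw [← Equiv.Perm.iterate_eq_pow, hk, Function.iterate_minimalPeriod]
  have apply_pow (p : ℕ) : π ((π ^ p) a) = (π ^ (p + 1)) a := by
    rw [pow_succ', Equiv.Perm.mul_apply]
  refine ⟨fun p => (π ^ p) a, m, hmono, apply_pow, fun j hij => ⟨ha j (hia.symm.trans hij), ?_⟩⟩
  obtain ⟨p, hp, rfl⟩ : ∃ p < k, (π ^ p) a = j := by
    obtain ⟨p, rfl⟩ := (hia.symm.trans hij).exists_nat_pow_eq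
    refine ⟨p % k, Nat.mod_lt _ (minimalPeriod_pos π a), ?_⟩
    simp only [← Equiv.Perm.iterate_eq_pow, hk, Function.iterate_mod_minimalPeriod_eq]
  rw [apply_pow]
  refine fun hlt => ⟨p, ?_, rfl⟩
  by_contra! hmp
  rcases (Nat.succ_le_of_lt hp).lt_or_eq with hp' | hp'
  · exact hlt.not_gt (hanti ⟨hmp, hp⟩ ⟨by omega, hp'⟩ p.lt_succ_self)
  · rw [← Nat.succ_eq_add_one, hp', pow_period] at hlt
    exact hlt.not_ge (ha _ (hia.symm.trans hij))

theorem unimodalCycles_iff : UnimodalCycles π ↔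
    ∀ v, v < π v → v < π.symm v → ∀ b, π.SameCycle v b → v ≤ b := by
  constructor
  · intro h v hv hv' b hb
    obtain ⟨s, m, hmono, hs, hcycle⟩ := h.exists_excedance_run v
    obtain ⟨p, hp, rfl⟩ := (hcycle v (.refl π v)).2 hv
    cases p with
    | zero => exact (hcycle b hb).1
    | succ p =>
      rw [← hs p, Equiv.symm_apply_apply, hs] at hv'
      exact absurd hv' (hmono (Set.mem_Iic.mpr (by omega)) (Set.mem_Iic.mpr hp.le)
        p.lt_succ_self).not_gt
  · intro h a ha
    have hinj : Set.InjOn (fun j : ℕ => (π ^ j) a) (Set.Iio (Function.minimalPeriod π a)) := by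
      simpa only [← Equiv.Perm.iterate_eq_pow] using Function.iterate_injOn_Iio_minimalPeriod
    refine exists_strictMonoOn_strictAntiOn (minimalPeriod_pos π a) hinj fun j hj hlt => ?_
    have apply_pow (p : ℕ) : (π ^ (p + 1)) a = π ((π ^ p) a) := by
      rw [pow_succ', Equiv.Perm.mul_apply]
    have ne_start : (π ^ (j + 1)) a ≠ a := fun heq =>
      j.succ_ne_zero (hinj (Set.mem_Iio.mpr (by omega)) (Set.mem_Iio.mpr (by omega)) heq)
    have hcycle : π.SameCycle a ((π ^ (j + 1)) a) :=
      Equiv.Perm.sameCycle_pow_right.mpr (.refl π a)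
    by_contra! hle
    have hne : (π ^ (j + 1)) a ≠ (π ^ (j + 2)) a := fun heq =>
      (j + 1).succ_ne_self.symm (hinj (Set.mem_Iio.mpr (by omega)) (Set.mem_Iio.mpr hj) heq)
    refine ne_start (le_antisymm (h _ ?_ ?_ a hcycle.symm) (ha _ hcycle))
    · rw [← apply_pow]
      exact lt_of_le_of_ne hle hne
    · rwa [apply_pow j, Equiv.symm_apply_apply, ← apply_pow]

theorem UnimodalCycles.symm (hπ : UnimodalCycles π) : UnimodalCycles π.symm := by
  rw [unimodalCycles_iff] at hπ ⊢
  exact fun v hv hv' b hb => hπ v hv' hv b (Equiv.Perm.sameCycle_inv.mp hb)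

theorem UnimodalCycles.noncrossingExcedances (hπ : UnimodalCycles π) (hπ' : NoncrossingCycles π) :
    NoncrossingExcedances π := by
  intro i j hij hj
  by_contra! hle
  have hlt : π i < π j := lt_of_le_of_ne hle (π.injective.ne hij.ne)
  by_cases hsame : π.SameCycle i j
  · obtain ⟨s, m, hmono, hs, hcycle⟩ := hπ.exists_excedance_run i
    obtain ⟨p, hp, rfl⟩ := (hcycle i (.refl π i)).2 (hij.trans hj)
    obtain ⟨r, hr, rfl⟩ := (hcycle j hsame).2 (hj.trans hlt)
    rw [hs, hmono.lt_iff_lt (Set.mem_Iic.mpr hr.le) (Set.mem_Iic.mpr hp)] at hj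
    rw [hmono.lt_iff_lt (Set.mem_Iic.mpr hp.le) (Set.mem_Iic.mpr hr.le)] at hij
    omega
  · exact hπ' ⟨i, j, π i, π j, hij, hj, hlt, by simp [Equiv.Perm.SameCycle.refl],
      by simp [Equiv.Perm.SameCycle.refl], hsame⟩

theorem rankMatched_pred_iff (π : Equiv.Perm (Fin n)) :
    RankMatched (fun h => h - 1) π ↔ UnimodalCycles π ∧ NoncrossingCycles π := by
  rw [RankMatched, rankMatchedExcedances_pred_iff, rankMatchedExcedances_pred_iff]
  constructor
  · intro h
    refine ⟨unimodalCycles_iff.mpr fun v hv hv' b hb => ?_, h.1.noncrossingCycles h.2⟩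
    obtain ⟨S, -, hvS, hS⟩ := h.1.exists_invariant_ordConnected h.2 hv.le hv'.le
    exact hvS.2 (hS v b hb hvS.1)
  · exact fun h => ⟨h.1.noncrossingExcedances h.2, h.1.symm.noncrossingExcedances h.2.symm⟩

theorem UnimodalCycles.cycCount_eq (hπ : UnimodalCycles π) :
    cycCount π = fpCount π + valleyCount π := by
  rw [cycCount, add_comm, Nat.add_left_cancel_iff, eq_comm]
  refine card_nbij π.cycleOf ?_ ?_ ?_
  · intro v hv
    have hv' : v < π v ∧ v < π.symm v := by simpa using hv
    rw [mem_coe, Equiv.Perm.cycleOf_mem_cycleFactorsFinset_iff, Equiv.Perm.mem_support]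
    exact hv'.1.ne'
  · intro v hv u hu huv
    obtain ⟨hv, hv'⟩ : v < π v ∧ v < π.symm v := by simpa using hv
    obtain ⟨hu, hu'⟩ : u < π u ∧ u < π.symm u := by simpa using hu
    have hsame : π.SameCycle v u :=
      (Equiv.Perm.sameCycle_iff_cycleOf_eq_of_mem_support
        (Equiv.Perm.mem_support.mpr hv.ne') (Equiv.Perm.mem_support.mpr hu.ne')).mpr huv
    rw [unimodalCycles_iff] at hπ
    exact le_antisymm (hπ v hv hv' u hsame) (hπ u hu hu' v hsame.symm)
  · intro c hc
    obtain ⟨i, hi⟩ := (Equiv.Perm.mem_cycleFactorsFinset_iff.mp hc).1.nonempty_support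
    obtain ⟨a, hia, ha⟩ := exists_sameCycle_forall_le π i
    have hne : π a ≠ a := Equiv.Perm.mem_support.mp
      (hia.mem_support_iff.mp (Equiv.Perm.mem_cycleFactorsFinset_support_le hc hi))
    refine ⟨a, ?_, by rw [Equiv.Perm.cycle_is_cycleOf hi hc, hia.cycleOf_eq]⟩
    rw [mem_coe, mem_filter]
    exact ⟨mem_univ a, lt_of_le_of_ne (ha _ (by simp [Equiv.Perm.SameCycle.refl])) hne.symm,
      lt_of_le_of_ne (ha _ (by simp [Equiv.Perm.SameCycle.refl]))
        (Ne.symm (symm_apply_eq_self_iff.not.mpr hne))⟩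

end NoncrossingArcs

section GeneratingFunctions

variable {R : Type*} [CommRing R]

theorem permGF_congr {P Q : ∀ n : ℕ, Equiv.Perm (Fin n) → Prop}
    {f g : ∀ n : ℕ, Equiv.Perm (Fin n) → R} (hPQ : ∀ n π, P n π ↔ Q n π)
    (hfg : ∀ n π, Q n π → f n π = g n π) : permGF P f = permGF Q g := by
  obtain rfl : P = Q := funext fun n => funext fun π => propext (hPQ n π)
  refine congrArg PowerSeries.mk (funext fun n => sum_congr rfl fun π hπ => hfg n π ?_)
  simpa using hπ

theorem permGF_unimodal_noncrossing (x v w t q : R) :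
    permGF (fun _ π => UnimodalCycles π ∧ NoncrossingCycles π)
        (fun _ π => x ^ fpCount π * v ^ excCount π * w ^ dexcCount π * t ^ cycCount π *
          q ^ invCount π) =
      jFraction (fun h => v * t * q ^ (4 * h - 3))
        (fun h => if h = 0 then x * t
          else x * t * q ^ (2 * h) + (1 + v * w) * q ^ (2 * h - 1)) := by
  trans permGF (fun _ π => RankMatched (fun h => h - 1) π) fun _ π =>
    (x * t) ^ fpCount π * v ^ excCount π * w ^ dexcCount π * t ^ valleyCount π * q ^ invCount π
  · refine permGF_congr (fun n π => (rankMatched_pred_iff π).symm) fun n π hπ => ?_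
    rw [((rankMatched_pred_iff π).mp hπ).1.cycCount_eq, mul_pow, pow_add]
    ring
  · rw [permGF_rankMatched fun h hh => Nat.sub_lt hh one_pos]
    refine jFraction_congr (fun h => ?_) fun h => ?_
    · congr 2
      omega
    · rcases h with _ | h
      · rfl
      · rw [if_neg h.succ_ne_zero, if_neg h.succ_ne_zero]
        congr 3
        omega

theorem permGF_increasing (x v w q : R) :
    permGF (fun _ π => IncreasingExcedances π ∧ IncreasingDeficiencies π)
        (fun _ π => x ^ fpCount π * v ^ excCount π * w ^ dexcCount π * q ^ invCount π) =
      jFraction (fun h => v * q ^ (2 * h - 1))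
        (fun h => if h = 0 then x else x * q ^ (2 * h) + (1 + v * w) * q ^ h) := by
  have h := permGF_rankMatched (κ := fun _ => 0) (fun h hh => hh) x v w 1 q
  simpa only [one_pow, mul_one, mul_zero, add_zero, rankMatched_zero_iff] using h

end GeneratingFunctions

theorem mainTheorem11 {R : Type*} [CommRing R] (x v w t q : R) :
    -- permutations with unimodal noncrossing cycles
    permGF (fun _ π => UnimodalCycles π ∧ NoncrossingCycles π)
        (fun _ π => x ^ fpCount π * v ^ excCount π * w ^ dexcCount π * t ^ cycCount π *
          q ^ invCount π) =
      jFraction (fun h => v * t * q ^ (4 * h - 3))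
        (fun h => if h = 0 then x * t
          else x * t * q ^ (2 * h) + (1 + v * w) * q ^ (2 * h - 1)) ∧
    -- permutations with increasing excedances and increasing deficiencies
    permGF (fun _ π => IncreasingExcedances π ∧ IncreasingDeficiencies π)
        (fun _ π => x ^ fpCount π * v ^ excCount π * w ^ dexcCount π * q ^ invCount π) =
      jFraction (fun h => v * q ^ (2 * h - 1))
        (fun h => if h = 0 then x else x * q ^ (2 * h) + (1 + v * w) * q ^ h) ∧
    -- `S` is the formal square root of `1 - 6z + 5z²` with constant coefficient `1`
    ∃ S : PowerSeries ℚ,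
      S ^ 2 = 1 - 6 * PowerSeries.X + 5 * PowerSeries.X ^ 2 ∧
      PowerSeries.constantCoeff S = 1 ∧
      permGF (fun _ π => UnimodalCycles π ∧ NoncrossingCycles π) (fun _ _ => (1 : ℚ)) =
        2 * (1 + PowerSeries.X + S)⁻¹ ∧
      permGF (fun _ π => IncreasingExcedances π ∧ IncreasingDeficiencies π)
          (fun _ _ => (1 : ℚ)) =
        2 * (1 + PowerSeries.X + S)⁻¹ ∧
      jFraction (fun _ => (1 : ℚ)) (fun h => if h = 0 then 1 else 3) =
        2 * (1 + PowerSeries.X + S)⁻¹ := by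
  refine ⟨permGF_unimodal_noncrossing x v w t q, permGF_increasing x v w q, ?_⟩
  obtain ⟨S, hS, hS_const, hJ⟩ := exists_sqrt_jFraction_eq (1 : ℚ) 1 3
  have discriminant : (1 - C (3 : ℚ) * X) ^ 2 - 4 * C 1 * X ^ 2 = 1 - 6 * X + 5 * X ^ 2 := by
    rw [map_ofNat, map_one]
    ring
  have unimodal := permGF_unimodal_noncrossing (1 : ℚ) 1 1 1 1
  have increasing := permGF_increasing (1 : ℚ) 1 1 1
  norm_num at hJ unimodal increasing
  exact ⟨S, hS.trans discriminant, hS_const, unimodal.trans hJ, increasing.trans hJ, hJ⟩
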